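/- Let $\Gamma$ be a commutative cancellative monoid, written additively, that is torsionless ($n\alpha=n\beta$ with $n\ge 1$ implies $\alpha=\beta$), with quotient group $\langle\Gamma\rangle$. Let $R=\bigoplus_{\alpha\in\Gamma}R_\alpha$ be a $\Gamma$-graded integral domain with quotient field $K$, and let $H$ be the set of nonzero homogeneous elements of $R$. For $\alpha\in\langle\Gamma\rangle$ let $(R_H)_\alpha\subseteq K$ consist of $0$ and all $a/b$ with $a\in R_\beta$, $0\ne b\in R_\gamma$, $\beta-\gamma=\alpha$; thus $R_H=\bigoplus_{\alpha\in\langle\Gamma\rangle}(R_H)_\alpha$. An $R$-submodule $E$ of $K$ is homogeneous if $E=\bigoplus_\alpha(E\cap(R_H)_\alpha)$. A homogeneous fractional ideal is an $R$-submodule $F$ of $K$ such that $hF$ is a homogeneous ideal of $R$ for some $h\in H$. A semistar operation on $R$ is a map $E\mapsto E^\star$ from the set of nonzero $R$-submodules of $K$ to itself such that, for all such $E,F$ and all $0\ne x\in K$: $(xE)^\star=xE^\star$; $E\subseteq F$ implies $E^\star\subseteq F^\star$; $E\subseteq E^\star$; $(E^\star)^\star=E^\star$. It is homogeneous preserving if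 $F^\star$ is a homogeneous $R$-submodule of $R_H$ for every nonzero homogeneous fractional ideal $F$. The associated semistar operation $\star_a$ is given by $$F^{\star_a}=\bigcup\{((FG)^\star:G^\star)\mid G\text{ a nonzero finitely generated fractional ideal}\},\qquad E^{\star_a}=\bigcup\{F^{\star_a}\mid F\subseteq E\text{ nonzero, finitely generated}\},$$ for nonzero finitely generated fractional ideals $F$ and nonzero $R$-submodules $E$ of $K$, where $(A:B)=\{x\in K\mid xB\subseteq A\}$. For $f=\sum_i f_iX^i\in R[X]$ let $\mathcal A_f$ be the ideal of $R$ generated by the homogeneous components of all $f_i$. For a semistar operation $\ast$ on $R$ put $$\mathrm{KR}(R,\ast)=\Big\{\tfrac fg\in K(X)\ \Big|\ f,g\in R[X],\ g\ne0,\ \mathcal A_f\mathcal A_h\subseteq(\mathcal A_g\mathcal A_h)^\ast\text{ for some }0\ne h\in R[X]\Big\}.$$ A valuation overring of $\mathrm{KR}(R,\ast)$ is a valuation ring of the field $K(X)$ containing $\mathrm{KR}(R,\ast)$. A gr-valuation overring of $R$ is a ring $V$ with $R\subseteq V\subseteq R_H$ and $V=\bigoplus_\alpha(V\cap(R_H)_\alpha)$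 such that $x\in V$ or $x^{-1}\in V$ for every nonzero homogeneous $x\in R_H$. It is a gr-$\star$-valuation overring if moreover $F^\star\subseteq FV$ for every nonzero finitely generated homogeneous fractional ideal $F$ of $R$. **Theorem.** Let $\star$ be a homogeneous preserving semistar operation on $R$, and let $V$ be an additive subgroup of $K$. Then $V$ is a gr-$\star$-valuation overring of $R$ if and only if there is a valuation overring $W$ of $\mathrm{KR}(R,\star_a)$ such that $V=\bigoplus_{\alpha\in\langle\Gamma\rangle}\big(W\cap(R_H)_\alpha\big)$. -/

import Mathlib

open scoped Pointwise

/-- A semistar operation on a domain `R` with quotient field `K`: a map `E ↦ E^⋆` on the nonzero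
`R`-submodules of `K` satisfying the four semistar axioms. It is presented as a map on all
`R`-submodules of `K`, normalized by `0^⋆ = 0`; each map on the nonzero submodules extends uniquely
in this way, and the four axioms for zero submodules are then automatic. -/
structure SemistarOperation (R K : Type*) [CommRing R] [Field K] [Algebra R K] where
  star : Submodule R K → Submodule R K
  star_bot : star ⊥ = ⊥
  star_smul : ∀ (x : K), x ≠ 0 → ∀ E : Submodule R K, star (x • E) = x • star E
  star_mono : ∀ E F : Submodule R K, E ≤ F → star E ≤ star F
  le_star : ∀ E : Submodule R K, E ≤ star E
  star_star : ∀ E : Submodule R K, star (star E) = star E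

namespace SemistarOperation

section Eab

variable {R K : Type*} [CommRing R] [Field K] [Algebra R K] (s : SemistarOperation R K)

theorem star_mul_le (E G : Submodule R K) : s.star E * G ≤ s.star (E * G) := by
  rw [Submodule.mul_le]
  intro m hm g hg
  by_cases h0 : g = 0
  · simp [h0]
  have h1 : g * m ∈ s.star (g • E) := by
    rw [s.star_smul g h0]
    exact Submodule.smul_mem_pointwise_smul m g _ hm
  rw [mul_comm m g]
  refine s.star_mono (g • E) _ ?_ h1
  intro y hy
  obtain ⟨e, he, rfl⟩ := (Submodule.mem_smul_pointwise_iff_exists y g E).1 hy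
  rw [smul_eq_mul, mul_comm g e]
  exact Submodule.mul_mem_mul he hg

theorem mul_ne_bot' {E F : Submodule R K} (hE : E ≠ ⊥) (hF : F ≠ ⊥) : E * F ≠ ⊥ := by
  obtain ⟨x, hx, hx0⟩ := Submodule.exists_mem_ne_zero_of_ne_bot hE
  obtain ⟨y, hy, hy0⟩ := Submodule.exists_mem_ne_zero_of_ne_bot hF
  intro h
  have := Submodule.mul_mem_mul hx hy
  rw [h, Submodule.mem_bot] at this
  exact (mul_ne_zero hx0 hy0) this

/-- For a finitely generated submodule `F` of `K`, the set
`F^{⋆_a} = ⋃ {((F H)^⋆ : H^⋆) | H a nonzero finitely generated submodule of K}`.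
Finitely generated submodules of `K` are the finitely generated fractional ideals of `R`. -/
def eabFG (F : Submodule R K) : Set K :=
  ⋃ (H : Submodule R K) (_ : H.FG ∧ H ≠ ⊥), ((s.star (F * H) / s.star H : Submodule R K) : Set K)

/-- For an arbitrary submodule `E` of `K`, the set
`E^{⋆_a} = ⋃ {F^{⋆_a} | F ⊆ E finitely generated}`. (The term `F = 0` contributes only `0`.) -/
def eabSet (E : Submodule R K) : Set K :=
  ⋃ (F : Submodule R K) (_ : F.FG ∧ F ≤ E), s.eabFG F

theorem mem_eabSet {E : Submodule R K} {x : K} :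
    x ∈ s.eabSet E ↔ ∃ F : Submodule R K, F.FG ∧ F ≤ E ∧
      ∃ H : Submodule R K, H.FG ∧ H ≠ ⊥ ∧ ∀ h ∈ H, x * h ∈ s.star (F * H) := by
  simp only [eabSet, eabFG, Set.mem_iUnion, SetLike.mem_coe, Submodule.mem_div_iff_forall_mul_mem]
  constructor
  · rintro ⟨F, ⟨hF, hFE⟩, H, ⟨hH, hH0⟩, h⟩
    exact ⟨F, hF, hFE, H, hH, hH0, fun y hy => h y (s.le_star H hy)⟩
  · rintro ⟨F, hF, hFE, H, hH, hH0, h⟩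
    refine ⟨F, ⟨hF, hFE⟩, H, ⟨hH, hH0⟩, fun y hy => ?_⟩
    by_cases hx : x = 0
    · simp [hx]
    have h1 : x • H ≤ s.star (F * H) := by
      intro z hz
      obtain ⟨e, he, rfl⟩ := (Submodule.mem_smul_pointwise_iff_exists z x H).1 hz
      exact h e he
    have h2 := s.star_mono _ _ h1
    rw [s.star_star, s.star_smul x hx] at h2
    exact h2 (Submodule.smul_mem_pointwise_smul y x _ hy)

theorem one_ne_bot' : (1 : Submodule R K) ≠ ⊥ := by
  intro h
  have : (1 : K) ∈ (1 : Submodule R K) := Submodule.one_le.1 le_rfl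
  rw [h, Submodule.mem_bot] at this
  exact one_ne_zero this

theorem one_fg' : (1 : Submodule R K).FG := by
  rw [Submodule.one_eq_span]
  exact Submodule.fg_span_singleton 1

theorem eabSet_add {E : Submodule R K} {x y : K} (hx : x ∈ s.eabSet E) (hy : y ∈ s.eabSet E) :
    x + y ∈ s.eabSet E := by
  rw [mem_eabSet] at *
  obtain ⟨F₁, hF₁, hE₁, H₁, hH₁, hb₁, h₁⟩ := hx
  obtain ⟨F₂, hF₂, hE₂, H₂, hH₂, hb₂, h₂⟩ := hy
  refine ⟨F₁ ⊔ F₂, hF₁.sup hF₂, sup_le hE₁ hE₂, H₁ * H₂, hH₁.mul hH₂, mul_ne_bot' hb₁ hb₂, ?_⟩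
  intro h hh
  rw [add_mul]
  refine add_mem ?_ ?_
  · have key : ∀ z ∈ H₁ * H₂, x * z ∈ s.star (F₁ * H₁) * H₂ := by
      intro z hz
      induction hz using Submodule.mul_induction_on' with
      | mem_mul_mem a ha b hb =>
        rw [← mul_assoc]; exact Submodule.mul_mem_mul (h₁ a ha) hb
      | add a _ b _ ha hb => rw [mul_add]; exact add_mem ha hb
    refine s.star_mono _ _ ?_ (s.star_mul_le _ _ (key h hh))
    rw [mul_assoc]
    exact mul_le_mul' le_sup_left le_rfl
  · have key : ∀ z ∈ H₁ * H₂, y * z ∈ s.star (F₂ * H₂) * H₁ := by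
      intro z hz
      induction hz using Submodule.mul_induction_on' with
      | mem_mul_mem a ha b hb =>
        rw [mul_comm a b, ← mul_assoc]; exact Submodule.mul_mem_mul (h₂ b hb) ha
      | add a _ b _ ha hb => rw [mul_add]; exact add_mem ha hb
    refine s.star_mono _ _ ?_ (s.star_mul_le _ _ (key h hh))
    rw [mul_assoc, mul_comm H₂ H₁]
    exact mul_le_mul' le_sup_right le_rfl

/-- The submodule `E^{⋆_a}`. -/
def eabSubmodule (E : Submodule R K) : Submodule R K where
  carrier := s.eabSet E
  add_mem' := s.eabSet_add
  zero_mem' := by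
    rw [mem_eabSet]
    exact ⟨⊥, Submodule.fg_bot, bot_le, 1, one_fg', one_ne_bot', by simp⟩
  smul_mem' := by
    intro r x hx
    rw [mem_eabSet] at *
    obtain ⟨F, hF, hE, H, hH, hb, h⟩ := hx
    refine ⟨F, hF, hE, H, hH, hb, fun y hy => ?_⟩
    rw [smul_mul_assoc]
    exact Submodule.smul_mem _ r (h y hy)

theorem mem_eabSubmodule {E : Submodule R K} {x : K} :
    x ∈ s.eabSubmodule E ↔ ∃ F : Submodule R K, F.FG ∧ F ≤ E ∧
      ∃ H : Submodule R K, H.FG ∧ H ≠ ⊥ ∧ ∀ h ∈ H, x * h ∈ s.star (F * H) :=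
  s.mem_eabSet

theorem eabSubmodule_mono {E F : Submodule R K} (h : E ≤ F) :
    s.eabSubmodule E ≤ s.eabSubmodule F := by
  intro x hx
  rw [mem_eabSubmodule] at *
  obtain ⟨G, hG, hE, H⟩ := hx
  exact ⟨G, hG, hE.trans h, H⟩

theorem le_eabSubmodule (E : Submodule R K) : E ≤ s.eabSubmodule E := by
  intro x hx
  rw [mem_eabSubmodule]
  refine ⟨Submodule.span R {x}, Submodule.fg_span_singleton x, by simpa using hx, 1,
    one_fg', one_ne_bot', fun h hh => ?_⟩
  exact s.le_star _ (Submodule.mul_mem_mul (Submodule.mem_span_singleton_self x) hh)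

theorem smul_eabSubmodule_le (x : K) (hx : x ≠ 0) (E : Submodule R K) :
    x • s.eabSubmodule E ≤ s.eabSubmodule (x • E) := by
  intro z hz
  obtain ⟨y, hy, rfl⟩ := (Submodule.mem_smul_pointwise_iff_exists z x _).1 hz
  rw [mem_eabSubmodule] at *
  obtain ⟨F, hF, hE, H, hH, hb, h⟩ := hy
  refine ⟨x • F, hF.map _, ?_, H, hH, hb, fun k hk => ?_⟩
  · exact Submodule.map_mono hE
  · have h1 : x • (F * H) ≤ (x • F) * H := by
      intro w hw
      obtain ⟨v, hv, rfl⟩ := (Submodule.mem_smul_pointwise_iff_exists w x _).1 hw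
      induction hv using Submodule.mul_induction_on' with
      | mem_mul_mem a ha b hb =>
        rw [smul_eq_mul, ← mul_assoc]
        exact Submodule.mul_mem_mul (Submodule.smul_mem_pointwise_smul a x _ ha) hb
      | add a ha b hb iha ihb =>
        rw [smul_add]
        exact add_mem (iha (Submodule.smul_mem_pointwise_smul _ _ _ ha))
          (ihb (Submodule.smul_mem_pointwise_smul _ _ _ hb))
    refine s.star_mono _ _ h1 ?_
    rw [s.star_smul x hx, smul_mul_assoc]
    exact Submodule.smul_mem_pointwise_smul _ _ _ (h k hk)

theorem exists_of_fg_le {E F : Submodule R K} (hF : F.FG) (h : F ≤ s.eabSubmodule E) :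
    ∃ G : Submodule R K, G.FG ∧ G ≤ E ∧ ∃ H : Submodule R K, H.FG ∧ H ≠ ⊥ ∧
      F * H ≤ s.star (G * H) := by
  induction F, hF using Submodule.fg_induction with
  | singleton x =>
    have hx : x ∈ s.eabSubmodule E := h (Submodule.mem_span_singleton_self x)
    rw [mem_eabSubmodule] at hx
    obtain ⟨G, hG, hE, H, hH, hb, hh⟩ := hx
    refine ⟨G, hG, hE, H, hH, hb, ?_⟩
    rw [Submodule.mul_le]
    intro m hm n hn
    obtain ⟨r, rfl⟩ := Submodule.mem_span_singleton.1 hm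
    rw [smul_mul_assoc]
    exact Submodule.smul_mem _ r (hh n hn)
  | sup F₁ F₂ _ _ ih₁ ih₂ =>
    obtain ⟨G₁, hG₁, hE₁, H₁, hH₁, hb₁, h₁⟩ := ih₁ (le_sup_left.trans h)
    obtain ⟨G₂, hG₂, hE₂, H₂, hH₂, hb₂, h₂⟩ := ih₂ (le_sup_right.trans h)
    refine ⟨G₁ ⊔ G₂, hG₁.sup hG₂, sup_le hE₁ hE₂, H₁ * H₂, hH₁.mul hH₂, mul_ne_bot' hb₁ hb₂, ?_⟩
    rw [Submodule.sup_mul]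
    refine sup_le ?_ ?_
    · calc F₁ * (H₁ * H₂) = (F₁ * H₁) * H₂ := (mul_assoc _ _ _).symm
        _ ≤ s.star (G₁ * H₁) * H₂ := mul_le_mul' h₁ le_rfl
        _ ≤ s.star (G₁ * H₁ * H₂) := s.star_mul_le _ _
        _ ≤ _ := s.star_mono _ _ (by rw [mul_assoc]; exact mul_le_mul' le_sup_left le_rfl)
    · calc F₂ * (H₁ * H₂) = (F₂ * H₂) * H₁ := by rw [mul_comm H₁, mul_assoc]
        _ ≤ s.star (G₂ * H₂) * H₁ := mul_le_mul' h₂ le_rfl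
        _ ≤ s.star (G₂ * H₂ * H₁) := s.star_mul_le _ _
        _ ≤ _ := s.star_mono _ _ (by
            rw [mul_assoc, mul_comm H₂]; exact mul_le_mul' le_sup_right le_rfl)

theorem eabSubmodule_idem (E : Submodule R K) :
    s.eabSubmodule (s.eabSubmodule E) = s.eabSubmodule E := by
  refine le_antisymm ?_ (s.le_eabSubmodule _)
  intro x hx
  rw [mem_eabSubmodule] at hx
  obtain ⟨F, hF, hFE, H, hH, hb, h⟩ := hx
  obtain ⟨G, hG, hGE, H', hH', hb', h'⟩ := s.exists_of_fg_le hF hFE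
  rw [mem_eabSubmodule]
  refine ⟨G, hG, hGE, H * H', hH.mul hH', mul_ne_bot' hb hb', ?_⟩
  have key : ∀ z ∈ H * H', x * z ∈ s.star (F * H) * H' := by
    intro z hz
    induction hz using Submodule.mul_induction_on' with
    | mem_mul_mem a ha b hb =>
      rw [← mul_assoc]; exact Submodule.mul_mem_mul (h a ha) hb
    | add a _ b _ ha hb => rw [mul_add]; exact add_mem ha hb
  have h3 : F * H * H' ≤ s.star (G * (H * H')) := by
    calc F * H * H' = F * H' * H := by rw [mul_assoc, mul_comm H, mul_assoc]
      _ ≤ s.star (G * H') * H := mul_le_mul' h' le_rfl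
      _ ≤ s.star (G * H' * H) := s.star_mul_le _ _
      _ = _ := by rw [mul_assoc, mul_comm H']
  intro z hz
  have h4 := s.star_mono _ _ h3 (s.star_mul_le _ _ (key z hz))
  rwa [s.star_star] at h4

/-- The e.a.b. semistar operation of finite type `⋆_a` associated to `⋆`. -/
def eab : SemistarOperation R K where
  star := s.eabSubmodule
  star_bot := by
    rw [eq_bot_iff]
    intro x hx
    rw [mem_eabSubmodule] at hx
    obtain ⟨F, hF, hE, H, hH, hb, h⟩ := hx
    obtain ⟨y, hy, hy0⟩ := Submodule.exists_mem_ne_zero_of_ne_bot hb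
    have h1 := h y hy
    rw [le_bot_iff.1 hE, Submodule.bot_mul, s.star_bot, Submodule.mem_bot] at h1
    rw [Submodule.mem_bot]
    exact (mul_eq_zero.1 h1).resolve_right hy0
  star_smul := by
    intro x hx E
    refine le_antisymm ?_ (s.smul_eabSubmodule_le x hx E)
    have h1 := s.smul_eabSubmodule_le x⁻¹ (inv_ne_zero hx) (x • E)
    rw [smul_smul, inv_mul_cancel₀ hx, one_smul] at h1
    intro z hz
    have h2 := h1 (Submodule.smul_mem_pointwise_smul z x⁻¹ _ hz)
    have h3 := Submodule.smul_mem_pointwise_smul _ x _ h2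
    rwa [smul_smul, mul_inv_cancel₀ hx, one_smul] at h3
  star_mono := fun _ _ h => s.eabSubmodule_mono h
  le_star := s.le_eabSubmodule
  star_star := s.eabSubmodule_idem

end Eab

end SemistarOperation

namespace GradedDomain

/-- `M = ⨁ᵢ A i`, an internal direct sum of additive subgroups. -/
def IsInternalDirectSum {L ι : Type*} [AddCommGroup L] (M : AddSubgroup L)
    (A : ι → AddSubgroup L) : Prop :=
  iSupIndep A ∧ M = ⨆ i, A i

section

variable {Γ : Type*} [AddCommMonoid Γ] [IsCancelAdd Γ] [DecidableEq Γ]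
  {R : Type*} [CommRing R] [IsDomain R] (𝒜 : Γ → AddSubgroup R) [GradedRing 𝒜]
  (K : Type*) [Field K] [Algebra R K] [IsFractionRing R K]

/-- The degree `α` part `(R_H)_α` of the homogeneous quotient field `R_H ⊆ K`, for `α` in the
quotient group `⟨Γ⟩` of `Γ`: the set of all `a / b` with `a ∈ R_β`, `0 ≠ b ∈ R_γ` and
`β - γ = α`. The clause `x = 0` only matters when there are no such `β`, `γ`, `b` at all (some
components of `R` may be zero); then the part is zero. -/
def quotPart (α : Algebra.GrothendieckAddGroup Γ) : AddSubgroup K where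
  carrier := {x | x = 0 ∨ ∃ β γ : Γ, ∃ a ∈ 𝒜 β, ∃ b ∈ 𝒜 γ, b ≠ 0 ∧
    Algebra.GrothendieckAddGroup.of β - Algebra.GrothendieckAddGroup.of γ = α ∧
    x = algebraMap R K a / algebraMap R K b}
  zero_mem' := Or.inl rfl
  add_mem' := by
    rintro x y (rfl | ⟨β, γ, a, ha, b, hb, hb0, hα, rfl⟩) hy
    · simpa using hy
    rcases hy with (rfl | ⟨β', γ', a', ha', b', hb', hb0', hα', rfl⟩)
    · exact Or.inr ⟨β, γ, a, ha, b, hb, hb0, hα, by rw [add_zero]⟩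
    have hdeg : β' + γ = β + γ' := by
      apply Algebra.GrothendieckAddGroup.of_injective
      rw [map_add, map_add]
      rw [sub_eq_iff_eq_add] at hα hα'
      rw [hα, hα']
      abel
    refine Or.inr ⟨β + γ', γ + γ', a * b' + a' * b,
      add_mem (SetLike.mul_mem_graded ha hb') (hdeg ▸ SetLike.mul_mem_graded ha' hb),
      b * b', SetLike.mul_mem_graded hb hb', mul_ne_zero hb0 hb0', ?_, ?_⟩
    · rw [map_add, map_add, add_sub_add_right_eq_sub, hα]
    · have h1 : algebraMap R K b ≠ 0 := by
        simpa using (IsFractionRing.injective R K).ne hb0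
      have h2 : algebraMap R K b' ≠ 0 := by
        simpa using (IsFractionRing.injective R K).ne hb0'
      simp only [map_add, map_mul]
      field_simp
  neg_mem' := by
    rintro x (rfl | ⟨β, γ, a, ha, b, hb, hb0, hα, rfl⟩)
    · exact Or.inl neg_zero
    · exact Or.inr ⟨β, γ, -a, neg_mem ha, b, hb, hb0, hα, by rw [map_neg, neg_div]⟩

/-- `M ∩ (R_H)_α`, for an additive subgroup `M` of `K`. -/
def capPart (M : AddSubgroup K) (α : Algebra.GrothendieckAddGroup Γ) : AddSubgroup K :=
  M ⊓ quotPart 𝒜 K α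

variable {K}

/-- An `R`-submodule `E` of `K` is homogeneous if `E = ⨁_α (E ∩ (R_H)_α)`; so `E ⊆ R_H`. -/
def IsHomogeneousSubmodule (E : Submodule R K) : Prop :=
  IsInternalDirectSum E.toAddSubgroup (capPart 𝒜 K E.toAddSubgroup)

/-- A homogeneous fractional ideal of `R`: an `R`-submodule `F` of `K` such that `h F` is a
homogeneous integral ideal of `R` for some nonzero homogeneous `h ∈ R`. -/
def IsHomogeneousFractionalIdeal (F : Submodule R K) : Prop :=
  ∃ h : R, h ≠ 0 ∧ SetLike.IsHomogeneousElem 𝒜 h ∧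
    ∃ I : Ideal R, I.IsHomogeneous 𝒜 ∧
      algebraMap R K h • F = IsLocalization.coeSubmodule K I

/-- `⋆` is homogeneous preserving: it sends homogeneous fractional ideals to homogeneous
submodules of `R_H` (which need not be fractional ideals, e.g. `R^⋆ = R_H` is allowed). -/
def IsHomogeneousPreserving (s : SemistarOperation R K) : Prop :=
  ∀ F : Submodule R K, F ≠ ⊥ → IsHomogeneousFractionalIdeal 𝒜 F →
    IsHomogeneousSubmodule 𝒜 (s.star F)

/-- `V` (an overring of `R` inside `K`) is a gr-valuation overring of `R`: it is a homogeneous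
overring, and for every nonzero homogeneous `x ∈ R_H` either `x ∈ V` or `x⁻¹ ∈ V`. -/
def IsGrValuationOverring (V : Subalgebra R K) : Prop :=
  IsHomogeneousSubmodule 𝒜 (Subalgebra.toSubmodule V) ∧
    ∀ (α : Algebra.GrothendieckAddGroup Γ), ∀ x ∈ quotPart 𝒜 K α, x ≠ 0 → x ∈ V ∨ x⁻¹ ∈ V

/-- The additive subgroup `V` of `K` is (the underlying group of) a gr-`⋆`-valuation overring of
`R`: a gr-valuation overring with `F^⋆ ⊆ F V` for all nonzero finitely generated homogeneous
fractional ideals `F` of `R`. -/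
def IsGrStarValuationOverring (s : SemistarOperation R K) (V : AddSubgroup K) : Prop :=
  ∃ A : Subalgebra R K, (Subalgebra.toSubmodule A).toAddSubgroup = V ∧
    IsGrValuationOverring 𝒜 A ∧
    ∀ F : Submodule R K, F ≠ ⊥ → F.FG → IsHomogeneousFractionalIdeal 𝒜 F →
      s.star F ≤ F * Subalgebra.toSubmodule A

/-- `C(a)`, the ideal of `R` generated by the homogeneous components of `a`. -/
def homogContent (a : R) : Ideal R :=
  Ideal.span (Set.range fun α : Γ => (DirectSum.decompose 𝒜 a α : R))

/-- The homogeneous content ideal `𝒜_f = ∑ᵢ C(fᵢ)` of a polynomial `f = ∑ᵢ fᵢ Xⁱ`. -/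
def polyHomogContent (f : Polynomial R) : Ideal R :=
  ∑ i ∈ Finset.range (f.natDegree + 1), homogContent 𝒜 (f.coeff i)

/-- The homogeneous Kronecker function ring `KR(R, ⋆)`, as a subset of `K(X)`. -/
def homogKronecker (s : SemistarOperation R K) : Set (RatFunc K) :=
  {φ | ∃ f g h : Polynomial R, g ≠ 0 ∧ h ≠ 0 ∧
    IsLocalization.coeSubmodule K (polyHomogContent 𝒜 f * polyHomogContent 𝒜 h) ≤
      s.star (IsLocalization.coeSubmodule K (polyHomogContent 𝒜 g * polyHomogContent 𝒜 h)) ∧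
    φ = algebraMap (Polynomial K) (RatFunc K) (f.map (algebraMap R K)) /
      algebraMap (Polynomial K) (RatFunc K) (g.map (algebraMap R K))}

/-- `W` is a valuation overring of `KR(R, ⋆)`: a valuation ring of the field `K(X)`
containing `KR(R, ⋆)`. -/
def IsValuationOverringOfKronecker (s : SemistarOperation R K) (W : ValuationSubring (RatFunc K)) :
    Prop :=
  homogKronecker 𝒜 s ⊆ (W : Set (RatFunc K))

/-- The additive group of `W ∩ K`, for a valuation ring `W` of `K(X)`. -/
noncomputable def constantsOf (W : ValuationSubring (RatFunc K)) : AddSubgroup K :=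
  (W.comap (algebraMap K (RatFunc K))).toSubring.toAddSubgroup

end

end GradedDomain

/-! In a gr-valuation overring `A` divisibility is total on homogeneous elements. Hence an ideal of
`R` generated by a finite set of homogeneous elements, not all zero, extends to `xA` for some
nonzero `x` in that set (`exists_dominant`). Both implications trade content ideals for such single
homogeneous elements.

From `A` to `W`: the homogeneous nonunits of `A` generate a homogeneous ideal `P`. It is prime
because the degree group is torsion-free, hence orderable, so primality can be tested on homogeneous
elements. Let `W` be a valuation ring of `K(X)` centred on `P[X]` in `A[X]`
(`exists_valuationSubring_of_isPrime`). A homogeneous `x` outside `A` has inverse in `P`, so `x` is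
not in `W`; thus `W` and `A` have the same homogeneous elements. For `f/g` in the Kronecker ring,
write `f = a p` and `g = b q` with `a`, `b` dominant components. Then `p`, `q` lie in `A[X]`, and
`q` is outside `P[X]` because some coefficient of it has `1` as a component. It remains that `a/b`
lies in `A`, which is `div_mem_of_mem_eab`: the auxiliary ideal hidden in `⋆_a` need not be
homogeneous, but it can be enlarged to a homogeneous one, and the gr-`⋆` condition then applies.

From `W` to `V`: since `F^⋆` is homogeneous, a homogeneous `y` in `F^⋆` is enough. After clearing
denominators, the generators of `F` become the coefficients of a polynomial `g`, and the Kronecker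
ring contains a constant multiple of `y/g`. Dividing `g` by its dominant coefficient gives an
element of `W`, so `y` divided by a single element of `F` lies in `W`, and being homogeneous it lies
in `V`. -/

/-! ### Torsion-free gradings and primality. -/

/-- The group embeds in its divisible hull, a rational vector space. Well-ordering a basis orders
that space lexicographically, and the order is pulled back. -/
theorem exists_linearOrder_isOrderedCancelAddMonoid (G : Type*) [AddCommGroup G]
    [IsAddTorsionFree G] : ∃ _ : LinearOrder G, IsOrderedCancelAddMonoid G := by
  let b := Module.Basis.ofVectorSpace ℚ (DivisibleHull G)
  let : LinearOrder (Module.Basis.ofVectorSpaceIndex ℚ (DivisibleHull G)) :=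
    IsWellOrder.linearOrder WellOrderingRel
  let f : G → Lex (Module.Basis.ofVectorSpaceIndex ℚ (DivisibleHull G) →₀ ℚ) :=
    fun g => toLex (b.repr (g : DivisibleHull G))
  have hf : Function.Injective f :=
    toLex.injective.comp (b.repr.injective.comp DivisibleHull.coe_injective)
  have hadd : ∀ x y, f (x + y) = f x + f y := fun x y => by
    simp [f, DivisibleHull.coe_add]
  let : LinearOrder G := LinearOrder.lift' f hf
  refine ⟨this, ?_⟩
  exact Function.Injective.isOrderedCancelAddMonoid f hadd Iff.rfl

/-- If `M = ⨆ i, M ⊓ A i` for an independent family `A`, then `M` contains the component of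
each of its elements. -/
theorem iSupIndep.component_mem {L ι : Type*} [AddCommGroup L] {A : ι → AddSubgroup L}
    (hA : iSupIndep A) {M : AddSubgroup L} (hM : M ≤ ⨆ i, M ⊓ A i) {i : ι} {a b : L}
    (ha : a ∈ A i) (hb : b ∈ ⨆ j, ⨆ _ : j ≠ i, A j) (hab : a + b ∈ M) : a ∈ M := by
  have h1 : (⨆ j, M ⊓ A j) ≤ (M ⊓ A i) ⊔ ⨆ j, ⨆ _ : j ≠ i, A j := by
    refine iSup_le fun j => ?_
    by_cases h : j = i
    · subst h; exact le_sup_left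
    · exact le_sup_of_le_right (inf_le_right.trans (le_iSup₂_of_le j h le_rfl))
  obtain ⟨a', ha', b', hb', h⟩ := AddSubgroup.mem_sup.1 (h1 (hM hab))
  have h2 : a - a' = b' - b := by
    rw [sub_eq_sub_iff_add_eq_add, ← h]; abel
  have h3 := AddSubgroup.disjoint_def.1 (hA i) (sub_mem ha ha'.2) (h2 ▸ sub_mem hb' hb)
  rw [sub_eq_zero.1 h3]
  exact ha'.1

/-- Criterion for primality of an ideal generated by homogeneous elements of a ring graded by a
torsion-free group. -/
theorem Ideal.isPrime_span_of_homogeneous {G B : Type*} [AddCommGroup G] [IsAddTorsionFree G]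
    [CommRing B] (𝒱 : G → AddSubgroup B) (h1 : (1 : B) ∈ 𝒱 0)
    (hmul : ∀ i j x y, x ∈ 𝒱 i → y ∈ 𝒱 j → x * y ∈ 𝒱 (i + j))
    (hind : iSupIndep 𝒱) (htop : ⨆ i, 𝒱 i = ⊤) (S : Set B) (hS : ∀ x ∈ S, ∃ i, x ∈ 𝒱 i)
    (hne : Ideal.span S ≠ ⊤)
    (hp : ∀ x y i j, x ∈ 𝒱 i → y ∈ 𝒱 j → x * y ∈ Ideal.span S →
      x ∈ Ideal.span S ∨ y ∈ Ideal.span S) :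
    (Ideal.span S).IsPrime ∧
      (Ideal.span S).toAddSubgroup ≤ ⨆ i, (Ideal.span S).toAddSubgroup ⊓ 𝒱 i := by
  -- The order provides extreme components of inhomogeneous elements; this is what reduces primality
  -- of a homogeneous ideal to homogeneous factors.
  obtain ⟨_, _⟩ := exists_linearOrder_isOrderedCancelAddMonoid G
  have hint : DirectSum.IsInternal 𝒱 := by
    refine ⟨hind.dfinsuppSumAddHom_injective, fun x => ?_⟩
    have hx : x ∈ ⨆ i, 𝒱 i := htop ▸ AddSubgroup.mem_top x
    have hle : (⨆ i, 𝒱 i) ≤ (DirectSum.coeAddMonoidHom 𝒱).range :=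
      iSup_le fun i y hy => ⟨DirectSum.of _ i ⟨y, hy⟩, by simp⟩
    exact hle hx
  let : DirectSum.Decomposition 𝒱 := hint.chooseDecomposition
  let : GradedRing 𝒱 :=
    { one_mem := h1, mul_mem := fun {i j x y} hx hy => hmul i j x y hx hy }
  have hh : (Ideal.span S).IsHomogeneous 𝒱 :=
    Ideal.homogeneous_span 𝒱 S fun x hx => hS x hx
  refine ⟨hh.isPrime_of_homogeneous_mem_or_mem hne ?_, fun x hx => ?_⟩
  · rintro x y ⟨i, hx⟩ ⟨j, hy⟩ hxy
    exact hp x y i j hx hy hxy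
  · classical
    rw [← DirectSum.sum_support_decompose 𝒱 x]
    refine AddSubgroup.sum_mem _ fun i _ => AddSubgroup.mem_iSup_of_mem i ?_
    exact ⟨hh i hx, SetLike.coe_mem _⟩

/-! ### The grading of the homogeneous quotient field. -/

namespace GradedDomain

theorem mul_mem_iSup_graded {Γ R : Type*} [AddCommMonoid Γ] [DecidableEq Γ] [CommRing R]
    (𝒜 : Γ → AddSubgroup R) [GradedRing 𝒜] {γ : Γ} {c : R} (hc : c ∈ 𝒜 γ) {p q : Γ → Prop}
    (h : ∀ δ, p δ → q (γ + δ)) {r : R} (hr : r ∈ ⨆ δ, ⨆ _ : p δ, 𝒜 δ) :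
    c * r ∈ ⨆ δ, ⨆ _ : q δ, 𝒜 δ := by
  have hle : (⨆ δ, ⨆ _ : p δ, 𝒜 δ) ≤ (⨆ δ, ⨆ _ : q δ, 𝒜 δ).comap (AddMonoidHom.mulLeft c) :=
    iSup₂_le fun δ hδ x hx =>
      AddSubgroup.mem_iSup_of_mem (γ + δ) (AddSubgroup.mem_iSup_of_mem (h δ hδ)
        (SetLike.mul_mem_graded hc hx))
  exact hle hr

section

variable {Γ : Type*} [AddCommMonoid Γ] [IsCancelAdd Γ] [DecidableEq Γ]
  {R : Type*} [CommRing R] [IsDomain R] (𝒜 : Γ → AddSubgroup R) [GradedRing 𝒜]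
  {K : Type*} [Field K] [Algebra R K] [IsFractionRing R K]

open Algebra.GrothendieckAddGroup (of of_injective)

theorem algebraMap_mem_quotPart {γ : Γ} {r : R} (hr : r ∈ 𝒜 γ) :
    algebraMap R K r ∈ quotPart 𝒜 K (of γ) :=
  Or.inr ⟨γ, 0, r, hr, 1, SetLike.GradedOne.one_mem, one_ne_zero, by simp, by simp⟩

theorem one_mem_quotPart : (1 : K) ∈ quotPart 𝒜 K 0 := by
  have h := algebraMap_mem_quotPart 𝒜 (K := K) (SetLike.GradedOne.one_mem (A := 𝒜))
  rwa [map_one, map_zero] at h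

theorem mul_mem_quotPart {α β : Algebra.GrothendieckAddGroup Γ} {x y : K}
    (hx : x ∈ quotPart 𝒜 K α) (hy : y ∈ quotPart 𝒜 K β) : x * y ∈ quotPart 𝒜 K (α + β) := by
  obtain rfl | ⟨b, c, a, ha, d, hd, hd0, rfl, rfl⟩ := hx
  · simp
  obtain rfl | ⟨b', c', a', ha', d', hd', hd0', rfl, rfl⟩ := hy
  · simp
  refine Or.inr ⟨b + b', c + c', a * a', SetLike.mul_mem_graded ha ha', d * d',
    SetLike.mul_mem_graded hd hd', mul_ne_zero hd0 hd0', ?_, ?_⟩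
  · rw [map_add, map_add]; abel
  · rw [map_mul, map_mul, div_mul_div_comm]

theorem inv_mem_quotPart {α : Algebra.GrothendieckAddGroup Γ} {x : K}
    (hx : x ∈ quotPart 𝒜 K α) : x⁻¹ ∈ quotPart 𝒜 K (-α) := by
  obtain rfl | ⟨b, c, a, ha, d, hd, hd0, rfl, rfl⟩ := hx
  · simp
  by_cases h : a = 0
  · simp [h]
  exact Or.inr ⟨c, b, d, hd, a, ha, h, by abel, by rw [inv_div]⟩

theorem div_mem_quotPart {α β : Algebra.GrothendieckAddGroup Γ} {x y : K}
    (hx : x ∈ quotPart 𝒜 K α) (hy : y ∈ quotPart 𝒜 K β) : x / y ∈ quotPart 𝒜 K (α - β) := by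
  rw [div_eq_mul_inv, sub_eq_add_neg]
  exact mul_mem_quotPart 𝒜 hx (inv_mem_quotPart 𝒜 hy)

theorem iSupIndep_quotPart : iSupIndep (quotPart 𝒜 K) := by
  intro α
  rw [AddSubgroup.disjoint_def]
  intro x hx hx'
  -- Elements that a nonzero homogeneous `b` carries to some `r` in `R` with no component in degree
  -- `α + deg b`. This is closed under addition and contains every part of degree other than `α`. An
  -- element `a/d` of degree `α` in it gives `b a = d r`, whose two sides share no degree, so both
  -- vanish.
  let S : AddSubgroup K :=
    { carrier := {z | ∃ γ : Γ, ∃ b ∈ 𝒜 γ, b ≠ 0 ∧ ∃ r ∈ ⨆ δ, ⨆ _ : of δ - of γ ≠ α, 𝒜 δ,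
        algebraMap R K b * z = algebraMap R K r}
      zero_mem' := ⟨0, 1, SetLike.GradedOne.one_mem, one_ne_zero, 0, zero_mem _, by simp⟩
      add_mem' := by
        rintro x y ⟨γ, b, hb, hb0, r, hr, h⟩ ⟨γ', b', hb', hb0', r', hr', h'⟩
        refine ⟨γ + γ', b * b', SetLike.mul_mem_graded hb hb', mul_ne_zero hb0 hb0',
          b' * r + b * r', add_mem (mul_mem_iSup_graded 𝒜 hb' (fun δ hδ => ?_) hr)
            (mul_mem_iSup_graded 𝒜 hb (fun δ hδ => ?_) hr'), ?_⟩
        · rwa [map_add, map_add, add_comm (of γ'), add_sub_add_right_eq_sub]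
        · rwa [map_add, map_add, add_sub_add_left_eq_sub]
        · simp only [map_add, map_mul, ← h, ← h']; ring
      neg_mem' := by
        rintro x ⟨γ, b, hb, hb0, r, hr, h⟩
        exact ⟨γ, b, hb, hb0, -r, neg_mem hr, by rw [mul_neg, map_neg, h]⟩ }
  have hle : (⨆ j, ⨆ _ : j ≠ α, quotPart 𝒜 K j) ≤ S := by
    refine iSup₂_le fun β hβ y hy => ?_
    obtain rfl | ⟨b, c, a, ha, d, hd, hd0, rfl, rfl⟩ := hy
    · exact zero_mem _
    · refine ⟨c, d, hd, hd0, a, AddSubgroup.mem_iSup_of_mem b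
        (AddSubgroup.mem_iSup_of_mem hβ ha), ?_⟩
      rw [mul_div_cancel₀]
      simpa using hd0
  obtain ⟨γ, b, hb, hb0, r, hr, h⟩ := hle hx'
  obtain rfl | ⟨β, γ', a, ha, d, hd, hd0, rfl, rfl⟩ := hx
  · rfl
  have hd1 : algebraMap R K d ≠ 0 := by simpa using hd0
  have h1 : b * a = d * r := by
    apply IsFractionRing.injective R K
    rw [map_mul, map_mul, ← h]
    field_simp
  have h2 : d * r ∈ ⨆ δ, ⨆ _ : δ ≠ γ + β, 𝒜 δ := by
    refine mul_mem_iSup_graded 𝒜 hd (fun δ hδ e => hδ ?_) hr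
    rw [sub_eq_sub_iff_add_eq_add, ← map_add, ← map_add, add_comm δ, e, add_comm]
  have h3 := AddSubgroup.disjoint_def.1
    ((DirectSum.Decomposition.isInternal 𝒜).addSubgroup_iSupIndep (γ + β))
    (SetLike.mul_mem_graded hb ha) (h1 ▸ h2)
  rw [(mul_eq_zero.1 h3).resolve_left hb0]
  simp

end

end GradedDomain

/-! ### Valuation rings with prescribed centre. -/

/-- A prime ideal of a subring of a field is the centre of some valuation ring. -/
theorem exists_valuationSubring_of_isPrime {B F : Type*} [CommRing B] [Field F] (φ : B →+* F)
    (hφ : Function.Injective φ) (Q : Ideal B) [Q.IsPrime] :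
    ∃ W : ValuationSubring F, (∀ b, φ b ∈ W) ∧ (∀ b ∉ Q, (φ b)⁻¹ ∈ W) ∧
      ∀ b ∈ Q, b ≠ 0 → (φ b)⁻¹ ∉ W := by
  have hu : ∀ y : Q.primeCompl, IsUnit (φ y) := fun y => by
    refine IsUnit.mk0 _ fun h => y.2 ?_
    rw [(injective_iff_map_eq_zero φ).1 hφ _ h]
    exact Q.zero_mem
  let f : Localization.AtPrime Q →+* F := IsLocalization.lift (M := Q.primeCompl) hu
  have hf : ∀ b, f (algebraMap B _ b) = φ b := fun b => IsLocalization.lift_eq hu b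
  -- `W` dominates the localization at `Q`: locality of the map into `W` keeps nonzero elements of
  -- `Q` from becoming units.
  obtain ⟨W, h, hloc⟩ := IsLocalRing.exists_factor_valuationRing f
  have hW : ∀ b, φ b ∈ W := fun b => hf b ▸ h (algebraMap B _ b)
  refine ⟨W, hW, fun b hb => ?_, fun b hb hb0 hbW => ?_⟩
  · obtain ⟨z, hz⟩ := (IsLocalization.map_units (Localization.AtPrime Q)
      (⟨b, hb⟩ : Q.primeCompl)).exists_right_inv
    have h1 : φ b * f z = 1 := by rw [← hf, ← map_mul, hz, map_one]
    rw [inv_eq_of_mul_eq_one_right h1]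
    exact h z
  · have hb1 : φ b ≠ 0 := (map_ne_zero_iff φ hφ).2 hb0
    have h1 : IsUnit (f.codRestrict W.toSubring h (algebraMap B _ b)) := by
      refine IsUnit.of_mul_eq_one (⟨(φ b)⁻¹, hbW⟩ : W.toSubring) (Subtype.ext ?_)
      change f (algebraMap B _ b) * (φ b)⁻¹ = 1
      rw [hf, mul_inv_cancel₀ hb1]
    have h2 := hloc.map_nonunit _ h1
    rw [IsLocalization.AtPrime.isUnit_to_map_iff _ Q] at h2
    exact h2 hb

/-! ### Homogeneous components and content ideals. -/

namespace GradedDomain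

section Components

variable {Γ : Type*} [AddCommMonoid Γ] [DecidableEq Γ]
  {R : Type*} [CommRing R] (𝒜 : Γ → AddSubgroup R) [GradedRing 𝒜]

/-- The set of the homogeneous components of the elements of `T`. -/
def componentSet (T : Set R) : Set R :=
  {x | ∃ t ∈ T, ∃ γ, x = (DirectSum.decompose 𝒜 t γ : R)}

theorem finite_componentSet {T : Set R} (hT : T.Finite) : (componentSet 𝒜 T).Finite := by
  classical
  have h : componentSet 𝒜 T ⊆ {0} ∪ ⋃ t ∈ T, (fun γ => (DirectSum.decompose 𝒜 t γ : R)) ''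
      ((DirectSum.decompose 𝒜 t).support : Set Γ) := by
    rintro _ ⟨t, ht, γ, rfl⟩
    by_cases h0 : DirectSum.decompose 𝒜 t γ = 0
    · left; simp [h0]
    · right
      exact Set.mem_biUnion ht ⟨γ, by simpa using h0, rfl⟩
  refine Set.Finite.subset ((Set.finite_singleton 0).union (hT.biUnion fun t _ => ?_)) h
  exact (Finset.finite_toSet _).image _

theorem isHomogeneousElem_of_mem_componentSet {T : Set R} :
    ∀ x ∈ componentSet 𝒜 T, SetLike.IsHomogeneousElem 𝒜 x := by
  rintro _ ⟨t, _, γ, rfl⟩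
  exact ⟨γ, SetLike.coe_mem _⟩

theorem subset_span_componentSet (T : Set R) : T ⊆ Ideal.span (componentSet 𝒜 T) := by
  classical
  intro t ht
  rw [← DirectSum.sum_support_decompose 𝒜 t]
  exact Ideal.sum_mem _ fun γ _ => Ideal.subset_span ⟨t, ht, γ, rfl⟩

theorem exists_mem_componentSet_ne_zero {T : Set R} {t : R} (ht : t ∈ T) (h0 : t ≠ 0) :
    ∃ x ∈ componentSet 𝒜 T, x ≠ 0 := by
  by_contra! h
  have : Ideal.span (componentSet 𝒜 T) = ⊥ := by rwa [Ideal.span_eq_bot]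
  have h1 := subset_span_componentSet 𝒜 T ht
  rw [this] at h1
  exact h0 h1

/-- The homogeneous content is generated by the homogeneous components of the coefficients. -/
theorem polyHomogContent_eq_span (f : Polynomial R) :
    polyHomogContent 𝒜 f =
      Ideal.span (componentSet 𝒜 (f.coeff '' (Finset.range (f.natDegree + 1) : Set ℕ))) := by
  have h : componentSet 𝒜 (f.coeff '' (Finset.range (f.natDegree + 1) : Set ℕ)) =
      ⋃ i ∈ Finset.range (f.natDegree + 1),
        Set.range fun γ : Γ => (DirectSum.decompose 𝒜 (f.coeff i) γ : R) := by
    ext x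
    simp only [componentSet, Set.mem_image, Set.mem_iUnion, Set.mem_range, Set.mem_ofPred_eq,
      exists_exists_and_eq_and, Finset.mem_coe, eq_comm (a := x), exists_prop]
  rw [h, polyHomogContent, Ideal.sum_eq_sup, Finset.sup_eq_iSup]
  simp only [homogContent, Ideal.span, Submodule.span_iUnion₂]

theorem coeff_mem_polyHomogContent (f : Polynomial R) (i : ℕ) :
    f.coeff i ∈ polyHomogContent 𝒜 f := by
  by_cases hi : i < f.natDegree + 1
  · rw [polyHomogContent_eq_span]
    exact subset_span_componentSet 𝒜 _ ⟨i, by simpa using hi, rfl⟩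
  · rw [Polynomial.coeff_eq_zero_of_natDegree_lt (by omega)]
    exact zero_mem _

end Components

theorem isHomogeneousFractionalIdeal_coeSubmodule {Γ : Type*} [AddCommMonoid Γ]
    [DecidableEq Γ] {R : Type*} [CommRing R] [IsDomain R] (𝒜 : Γ → AddSubgroup R) [GradedRing 𝒜]
    {K : Type*} [Field K] [Algebra R K] {I : Ideal R} (hI : I.IsHomogeneous 𝒜) :
    IsHomogeneousFractionalIdeal 𝒜 (IsLocalization.coeSubmodule K I) :=
  ⟨1, one_ne_zero, ⟨0, SetLike.GradedOne.one_mem⟩, I, hI, by rw [map_one, one_smul]⟩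

/-! ### Dominant homogeneous elements and the operation `⋆_a`. -/

section

variable {Γ : Type*} [AddCommMonoid Γ] [IsCancelAdd Γ] [DecidableEq Γ]
  {R : Type*} [CommRing R] [IsDomain R] (𝒜 : Γ → AddSubgroup R) [GradedRing 𝒜]
  {K : Type*} [Field K] [Algebra R K] [IsFractionRing R K]

open Algebra.GrothendieckAddGroup (of of_injective)

/-- Of two nonzero homogeneous elements one divides the other in `A`, since their quotient is
homogeneous. Induction keeps whichever of the new element and the old dominant one divides the
other. -/
theorem exists_dominant_of_finite {A : Subalgebra R K} (hA : IsGrValuationOverring 𝒜 A)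
    {T : Set K} (hT : T.Finite) (hne : T.Nonempty)
    (hh : ∀ x ∈ T, x ≠ 0 ∧ ∃ α, x ∈ quotPart 𝒜 K α) :
    ∃ t ∈ T, ∀ u ∈ T, u / t ∈ A := by
  induction T, hT using Set.Finite.induction_on with
  | empty => exact absurd hne Set.not_nonempty_empty
  | @insert a s _ _ ih =>
    obtain rfl | hs := s.eq_empty_or_nonempty
    · refine ⟨a, by simp, fun u hu => ?_⟩
      obtain rfl : u = a := by simpa using hu
      rw [div_self (hh u (by simp)).1]
      exact one_mem A
    obtain ⟨t, ht, h⟩ := ih hs fun x hx => hh x (Set.mem_insert_of_mem a hx)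
    obtain ⟨ha0, α, ha⟩ := hh a (Set.mem_insert a s)
    obtain ⟨ht0, β, htβ⟩ := hh t (Set.mem_insert_of_mem a ht)
    rcases hA.2 _ _ (div_mem_quotPart 𝒜 ha htβ) (div_ne_zero ha0 ht0) with hat | hat
    · refine ⟨t, Set.mem_insert_of_mem a ht, fun u hu => ?_⟩
      obtain rfl | hu := hu
      · exact hat
      · exact h u hu
    · refine ⟨a, Set.mem_insert a s, fun u hu => ?_⟩
      obtain rfl | hu := hu
      · rw [div_self ha0]; exact one_mem A
      · have := mul_mem (h u hu) hat
        rwa [inv_div, div_mul_div_cancel₀ ht0] at this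

theorem exists_dominant {A : Subalgebra R K} (hA : IsGrValuationOverring 𝒜 A)
    {S : Set R} (hS : S.Finite) (hne : ∃ x ∈ S, x ≠ 0)
    (hh : ∀ x ∈ S, SetLike.IsHomogeneousElem 𝒜 x) :
    ∃ x ∈ S, x ≠ 0 ∧ ∀ y ∈ Ideal.span S, algebraMap R K y / algebraMap R K x ∈ A := by
  obtain ⟨t, ⟨x, ⟨hx, hx0⟩, rfl⟩, h⟩ := exists_dominant_of_finite 𝒜 hA
    (T := algebraMap R K '' {x ∈ S | x ≠ 0})
    ((hS.subset (Set.sep_subset _ _)).image _)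
    (by obtain ⟨x, hx⟩ := hne; exact ⟨_, x, hx, rfl⟩)
    (by
      rintro _ ⟨x, ⟨hx, hx0⟩, rfl⟩
      obtain ⟨γ, hγ⟩ := hh x hx
      exact ⟨by simpa using hx0, _, algebraMap_mem_quotPart 𝒜 hγ⟩)
  refine ⟨x, hx, hx0, fun y hy => ?_⟩
  induction hy using Submodule.span_induction with
  | mem y hy =>
    by_cases hy0 : y = 0
    · simp [hy0]
    · exact h _ ⟨y, ⟨hy, hy0⟩, rfl⟩
  | zero => simp
  | add y z _ _ hy hz => rw [map_add, add_div]; exact add_mem hy hz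
  | smul r y _ hy =>
    rw [smul_eq_mul, map_mul, mul_div_assoc]
    exact mul_mem (A.algebraMap_mem r) hy

/-- Multiplication by `c` shifts degrees injectively, and `Γ` embeds in its quotient group, so the
components of `r` stay in distinct degrees and a homogeneous `M` contains each of them. -/
theorem mul_component_mem {M : AddSubgroup K} (hM : M ≤ ⨆ α, M ⊓ quotPart 𝒜 K α)
    {α : Algebra.GrothendieckAddGroup Γ} {c : K} (hc : c ∈ quotPart 𝒜 K α) {r : R} (γ : Γ)
    (h : c * algebraMap R K r ∈ M) :
    c * algebraMap R K (DirectSum.decompose 𝒜 r γ : R) ∈ M := by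
  classical
  have key : ∀ δ, c * algebraMap R K (DirectSum.decompose 𝒜 r δ : R) ∈ quotPart 𝒜 K (α + of δ) :=
    fun δ => mul_mem_quotPart 𝒜 hc (algebraMap_mem_quotPart 𝒜 (SetLike.coe_mem _))
  refine (iSupIndep_quotPart 𝒜).component_mem hM
    (b := c * algebraMap R K (∑ δ ∈ (DirectSum.decompose 𝒜 r).support.erase γ,
      (DirectSum.decompose 𝒜 r δ : R))) (key γ) ?_ ?_
  · rw [map_sum, Finset.mul_sum]
    refine AddSubgroup.sum_mem _ fun δ hδ => AddSubgroup.mem_iSup_of_mem _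
      (AddSubgroup.mem_iSup_of_mem (fun e => ?_) (key δ))
    exact Finset.ne_of_mem_erase hδ (of_injective (add_left_cancel e))
  · rw [← mul_add, ← map_add]
    convert h using 3
    by_cases hγ : γ ∈ (DirectSum.decompose 𝒜 r).support
    · rw [Finset.add_sum_erase _ (fun δ => (DirectSum.decompose 𝒜 r δ : R)) hγ,
        DirectSum.sum_support_decompose]
    · rw [Finset.erase_eq_of_notMem hγ, DirectSum.sum_support_decompose]
      simpa using hγ

theorem le_iSup_of_isHomogeneousSubmodule {A : Subalgebra R K}
    (hA : IsHomogeneousSubmodule 𝒜 (Subalgebra.toSubmodule A)) :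
    (Subalgebra.toSubmodule A).toAddSubgroup ≤
      ⨆ α, (Subalgebra.toSubmodule A).toAddSubgroup ⊓ quotPart 𝒜 K α :=
  hA.2.le

/-- The Kronecker condition for homogeneous elements: if `r` is homogeneous and lies in
`I^{⋆_a}`, then `r ∈ b A` whenever `I ⊆ b A`. -/
theorem div_mem_of_mem_eab (s : SemistarOperation R K) {A : Subalgebra R K}
    (hA : IsGrValuationOverring 𝒜 A)
    (hsA : ∀ F : Submodule R K, F ≠ ⊥ → F.FG → IsHomogeneousFractionalIdeal 𝒜 F →
      s.star F ≤ F * Subalgebra.toSubmodule A)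
    {S : Set R} (hS : S.Finite) (hSh : ∀ x ∈ S, SetLike.IsHomogeneousElem 𝒜 x)
    {r b : R} (hr : SetLike.IsHomogeneousElem 𝒜 r) (hb : SetLike.IsHomogeneousElem 𝒜 b)
    (hdom : ∀ y ∈ Ideal.span S, algebraMap R K y / algebraMap R K b ∈ A)
    (hmem : algebraMap R K r ∈ s.eab.star (IsLocalization.coeSubmodule K (Ideal.span S))) :
    algebraMap R K r / algebraMap R K b ∈ A := by
  obtain ⟨F, -, hFI, G, hG, hG0, h⟩ := s.mem_eabSubmodule.1 hmem
  obtain ⟨T, rfl⟩ := hG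
  obtain ⟨⟨d, hd⟩, hdT⟩ := IsLocalization.exist_integer_multiples_of_finset (nonZeroDivisors R) T
  have hd0 : algebraMap R K d ≠ 0 := by simpa using nonZeroDivisors.ne_zero hd
  -- The generators of the auxiliary module `G` after clearing denominators. Their components
  -- generate a homogeneous ideal containing `dG`.
  let J : Set R := {j | ∃ t ∈ T, algebraMap R K j = algebraMap R K d * t}
  have hJ : J.Finite := by
    refine Set.Finite.of_finite_image (f := algebraMap R K)
      ((T.finite_toSet.image (algebraMap R K d * ·)).subset ?_)
      (IsFractionRing.injective R K).injOn
    rintro _ ⟨j, ⟨t, ht, hj⟩, rfl⟩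
    exact ⟨t, ht, hj.symm⟩
  have hTJ : ∀ t ∈ T, ∃ j ∈ J, algebraMap R K j = algebraMap R K d * t := fun t ht => by
    obtain ⟨j, hj⟩ := hdT t ht
    rw [Algebra.smul_def] at hj
    exact ⟨j, ⟨t, ht, hj⟩, hj⟩
  have hne : ∃ x ∈ componentSet 𝒜 J, x ≠ 0 := by
    obtain ⟨t, ht, ht0⟩ : ∃ t ∈ T, t ≠ 0 := by
      by_contra! hc
      exact hG0 (Submodule.span_eq_bot.2 hc)
    obtain ⟨j, hj, e⟩ := hTJ t ht
    refine exists_mem_componentSet_ne_zero 𝒜 hj fun h0 => ?_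
    rw [h0, map_zero] at e
    exact mul_ne_zero hd0 ht0 e.symm
  obtain ⟨_, ⟨j, ⟨t, ht, hj⟩, γ, rfl⟩, hx0, hx⟩ := exists_dominant 𝒜 hA
    (finite_componentSet 𝒜 hJ) hne (isHomogeneousElem_of_mem_componentSet 𝒜)
  set x : R := (DirectSum.decompose 𝒜 j γ : R) with hxdef
  have hx1 : algebraMap R K x ≠ 0 := by simpa using hx0
  let I' : Ideal R := Ideal.span S * Ideal.span (componentSet 𝒜 J)
  have hI'h : I'.IsHomogeneous 𝒜 := by
    refine Ideal.IsHomogeneous.mul (Ideal.homogeneous_span 𝒜 _ hSh)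
      (Ideal.homogeneous_span 𝒜 _ (isHomogeneousElem_of_mem_componentSet 𝒜))
  have hI'fg : I'.FG := by
    refine Submodule.FG.mul ⟨hS.toFinset, by simp [Ideal.span]⟩
      ⟨(finite_componentSet 𝒜 hJ).toFinset, by simp [Ideal.span]⟩
  have hle : algebraMap R K d • (F * Submodule.span R (T : Set K)) ≤
      IsLocalization.coeSubmodule K I' := by
    have h1 : algebraMap R K d • Submodule.span R (T : Set K) ≤
        IsLocalization.coeSubmodule K (Ideal.span (componentSet 𝒜 J)) := by
      rw [Submodule.smul_span, Submodule.span_le]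
      rintro _ ⟨t, ht, rfl⟩
      obtain ⟨j, hj, e⟩ := hTJ t ht
      exact ⟨j, subset_span_componentSet 𝒜 J hj, e⟩
    rw [IsLocalization.coeSubmodule_mul]
    rintro _ ⟨z, hz, rfl⟩
    induction hz using Submodule.mul_induction_on' with
    | mem_mul_mem m hm n hn =>
      have h2 := Submodule.mul_mem_mul (hFI hm)
        (h1 (Submodule.smul_mem_pointwise_smul n (algebraMap R K d) _ hn))
      rw [smul_eq_mul, mul_left_comm] at h2
      exact h2
    | add m _ n _ hm hn => rw [map_add]; exact add_mem hm hn
  -- Only the one generator `t` whose multiple `j = d t` has the dominant `x` as a component is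
  -- used, so replacing `dG` by a larger homogeneous ideal on the right is harmless.
  have hstar : algebraMap R K r * algebraMap R K j ∈
      s.star (IsLocalization.coeSubmodule K I') := by
    refine s.star_mono _ _ hle ?_
    rw [s.star_smul _ hd0, hj, mul_left_comm]
    exact Submodule.smul_mem_pointwise_smul _ _ _ (h t (Submodule.subset_span ht))
  by_cases hr0 : r = 0
  · simp [hr0]
  have hj0 : j ≠ 0 := by rintro rfl; exact hx0 (by simp [hxdef])
  have hI'0 : IsLocalization.coeSubmodule K I' ≠ ⊥ := by
    intro e
    rw [e, s.star_bot, Submodule.mem_bot, ← map_mul] at hstar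
    exact mul_ne_zero hr0 hj0 ((IsFractionRing.injective R K) (by rw [hstar, map_zero]))
  have hIA := hsA _ hI'0 (Submodule.FG.map _ hI'fg)
    (isHomogeneousFractionalIdeal_coeSubmodule 𝒜 hI'h) hstar
  have hdiv : ∀ z ∈ IsLocalization.coeSubmodule K I' * Subalgebra.toSubmodule A,
      z / (algebraMap R K b * algebraMap R K x) ∈ A := by
    intro z hz
    induction hz using Submodule.mul_induction_on' with
    | mem_mul_mem m hm n hn =>
      rw [mul_div_right_comm]
      refine mul_mem ?_ hn
      rw [IsLocalization.coeSubmodule_mul] at hm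
      induction hm using Submodule.mul_induction_on' with
      | mem_mul_mem p hp q hq =>
        obtain ⟨p, hp, rfl⟩ := hp
        obtain ⟨q, hq, rfl⟩ := hq
        rw [mul_div_mul_comm]
        exact mul_mem (hdom p hp) (hx q hq)
      | add p _ q _ hp hq => rw [add_div]; exact add_mem hp hq
    | add m _ n _ hm hn => rw [add_div]; exact add_mem hm hn
  have hfin := hdiv _ hIA
  rw [mul_div_right_comm] at hfin
  obtain ⟨δ, hδ⟩ := hr
  obtain ⟨ε, hε⟩ := hb
  -- The component of `r j / (b x)` coming from `j_γ = x` is `r x / (b x) = r / b`.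
  have hcomp := mul_component_mem 𝒜 (le_iSup_of_isHomogeneousSubmodule 𝒜 hA.1)
    (div_mem_quotPart 𝒜 (algebraMap_mem_quotPart 𝒜 hδ) (mul_mem_quotPart 𝒜
      (algebraMap_mem_quotPart 𝒜 hε) (algebraMap_mem_quotPart 𝒜 (SetLike.coe_mem _)))) γ hfin
  rwa [← hxdef, div_mul_eq_mul_div, mul_div_mul_right _ _ hx1] at hcomp

end

end GradedDomain

/-! ### From gr-`⋆`-valuation overrings to valuation rings of `K(X)`. -/

namespace GradedDomain

/-- `x⁻¹ f` as a polynomial over `A`, when `A` contains the quotients of the coefficients. -/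
theorem exists_map_eq_inv_mul {R K : Type*} [CommRing R] [Field K] [Algebra R K] {A : Subalgebra R K} {f : Polynomial R} {x : R}
    (h : ∀ i, algebraMap R K (f.coeff i) / algebraMap R K x ∈ A) :
    ∃ p : Polynomial A, (∀ i, (p.coeff i : K) = (algebraMap R K x)⁻¹ * algebraMap R K (f.coeff i)) ∧
      p.map (A.val : A →+* K) =
        Polynomial.C (algebraMap R K x)⁻¹ * f.map (algebraMap R K) := by
  have : Polynomial.C (algebraMap R K x)⁻¹ * f.map (algebraMap R K) ∈
      Polynomial.lifts (A.val : A →+* K) := by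
    rw [Polynomial.lifts_iff_coeff_lifts]
    intro i
    refine ⟨⟨_, h i⟩, ?_⟩
    simp [div_eq_inv_mul]
  obtain ⟨p, hp⟩ := (Polynomial.mem_lifts _).1 this
  refine ⟨p, fun i => ?_, hp⟩
  have := congrArg (fun q => Polynomial.coeff q i) hp
  simpa using this

section

variable {Γ : Type*} [AddCommMonoid Γ] [IsCancelAdd Γ] [DecidableEq Γ]
  {R : Type*} [CommRing R] [IsDomain R] (𝒜 : Γ → AddSubgroup R) [GradedRing 𝒜]
  {K : Type*} [Field K] [Algebra R K] [IsFractionRing R K]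

open Algebra.GrothendieckAddGroup (of of_injective)

/-- The ideal generated by the homogeneous nonunits of a gr-valuation overring is prime. -/
theorem exists_prime_homogeneous_nonunits [IsAddTorsionFree Γ] {A : Subalgebra R K}
    (hA : IsGrValuationOverring 𝒜 A) :
    ∃ P : Ideal A, P.IsPrime ∧
      (∀ (x : A) (α : Algebra.GrothendieckAddGroup Γ), (x : K) ∈ quotPart 𝒜 K α →
        (x ∈ P ↔ ¬ IsUnit x)) ∧
      P.toAddSubgroup.map (A.val : A →+ K) ≤
        ⨆ α, P.toAddSubgroup.map (A.val : A →+ K) ⊓ quotPart 𝒜 K α := by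
  have : IsAddTorsionFree (Algebra.GrothendieckAddGroup Γ) :=
    inferInstanceAs (IsAddTorsionFree (AddLocalization (⊤ : AddSubmonoid Γ)))
  let 𝒱 : Algebra.GrothendieckAddGroup Γ → AddSubgroup A := fun α =>
    (quotPart 𝒜 K α).comap (A.val : A →+ K)
  have hinj : Function.Injective (A.val : A →+ K) := Subtype.val_injective
  have hind : iSupIndep 𝒱 := by
    intro α
    rw [AddSubgroup.disjoint_def]
    intro x hx hx'
    have h : (⨆ j, ⨆ _ : j ≠ α, 𝒱 j) ≤
        (⨆ j, ⨆ _ : j ≠ α, quotPart 𝒜 K j).comap (A.val : A →+ K) :=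
      iSup₂_le fun j hj y hy => AddSubgroup.mem_iSup_of_mem j (AddSubgroup.mem_iSup_of_mem hj hy)
    exact Subtype.ext (AddSubgroup.disjoint_def.1 (iSupIndep_quotPart 𝒜 α) hx (h hx'))
  have htop : ⨆ α, 𝒱 α = ⊤ := by
    rw [eq_top_iff]
    rintro ⟨x, hx⟩ -
    have h : (⨆ α, (Subalgebra.toSubmodule A).toAddSubgroup ⊓ quotPart 𝒜 K α) ≤
        (⨆ α, 𝒱 α).map (A.val : A →+ K) := by
      refine iSup_le fun α y hy => ⟨⟨y, hy.1⟩, AddSubgroup.mem_iSup_of_mem α hy.2, rfl⟩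
    obtain ⟨z, hz, e⟩ := h (le_iSup_of_isHomogeneousSubmodule 𝒜 hA.1 hx)
    rwa [← show z = ⟨x, hx⟩ from Subtype.ext e]
  let S : Set A := {x | (∃ α, x ∈ 𝒱 α) ∧ ¬ IsUnit x}
  -- If `1` were a combination of finitely many homogeneous nonunits, it would be a multiple of the
  -- dominant one `t`, making `t` a unit.
  have hne : Ideal.span S ≠ ⊤ := by
    rw [Ideal.ne_top_iff_one]
    intro h1
    obtain ⟨T, hTS, h1⟩ := Submodule.mem_span_finite_of_mem_span h1
    obtain hemp | hTne := (((fun x : A => (x : K)) '' T) \ {0}).eq_empty_or_nonempty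
    · have : Submodule.span A (T : Set A) = ⊥ := by
        rw [Submodule.span_eq_bot]
        intro x hx
        by_contra h0
        have hmem : (x : K) ∈ ((fun x : A => (x : K)) '' T) \ {0} :=
          ⟨⟨x, hx, rfl⟩, by simpa using h0⟩
        rw [hemp] at hmem
        exact hmem
      rw [this, Submodule.mem_bot] at h1
      exact one_ne_zero h1
    · obtain ⟨_, ⟨⟨t, ht, rfl⟩, ht0⟩, hdom⟩ := exists_dominant_of_finite 𝒜 hA
        ((T.finite_toSet.image (fun x : A => (x : K))).subset Set.sdiff_subset) hTne (by
          rintro _ ⟨⟨x, hx, rfl⟩, hx0⟩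
          exact ⟨hx0, (hTS hx).1⟩)
      have hdiv : ∀ y ∈ Submodule.span A (T : Set A), (y : K) / (t : K) ∈ A := by
        intro y hy
        induction hy using Submodule.span_induction with
        | mem y hy =>
          by_cases hy0 : (y : K) = 0
          · rw [hy0, zero_div]; exact zero_mem A
          · exact hdom _ ⟨⟨y, hy, rfl⟩, hy0⟩
        | zero => simp
        | add y z _ _ hy hz => rw [AddMemClass.coe_add, add_div]; exact add_mem hy hz
        | smul r y _ hy =>
          rw [smul_eq_mul, MulMemClass.coe_mul, mul_div_assoc]
          exact mul_mem r.2 hy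
      refine (hTS ht).2 (IsUnit.of_mul_eq_one ⟨_, hdiv 1 h1⟩ (Subtype.ext ?_))
      exact mul_div_cancel₀ _ ht0
  have hmem : ∀ (x : A) (α : Algebra.GrothendieckAddGroup Γ), (x : K) ∈ quotPart 𝒜 K α →
      (x ∈ Ideal.span S ↔ ¬ IsUnit x) := fun x α hx =>
    ⟨fun h hu => hne (Ideal.eq_top_of_isUnit_mem _ h hu), fun h => Ideal.subset_span ⟨⟨α, hx⟩, h⟩⟩
  obtain ⟨hP, hcomp⟩ := Ideal.isPrime_span_of_homogeneous 𝒱 (one_mem_quotPart 𝒜)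
    (fun i j x y hx hy => mul_mem_quotPart 𝒜 hx hy) hind htop S (fun x hx => hx.1) hne (by
      intro x y i j hx hy hxy
      rw [hmem _ _ (mul_mem_quotPart 𝒜 hx hy : ((x * y : A) : K) ∈ _)] at hxy
      rw [hmem _ _ hx, hmem _ _ hy]
      by_contra! h
      exact hxy (h.1.mul h.2))
  refine ⟨Ideal.span S, hP, hmem, ?_⟩
  refine (AddSubgroup.map_mono hcomp).trans ?_
  rw [AddSubgroup.map_iSup]
  refine iSup_mono fun α => ?_
  rintro _ ⟨x, hx, rfl⟩
  exact ⟨⟨x, hx.1, rfl⟩, hx.2⟩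

/-- The indices `i`, `γ` are kept so that, after division by the dominant component, a specific
coefficient is known to have component `1`. -/
theorem exists_poly_dominant {A : Subalgebra R K} (hA : IsGrValuationOverring 𝒜 A)
    {f : Polynomial R} (hf : f ≠ 0) :
    ∃ i γ, (DirectSum.decompose 𝒜 (f.coeff i) γ : R) ≠ 0 ∧
      (DirectSum.decompose 𝒜 (f.coeff i) γ : R) ∈ polyHomogContent 𝒜 f ∧
      ∀ y ∈ polyHomogContent 𝒜 f,
        algebraMap R K y / algebraMap R K (DirectSum.decompose 𝒜 (f.coeff i) γ : R) ∈ A := by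
  rw [polyHomogContent_eq_span]
  obtain ⟨_, ⟨_, ⟨i, hi, rfl⟩, γ, rfl⟩, hx0, hx⟩ := exists_dominant 𝒜 hA
    (finite_componentSet 𝒜 ((Finset.finite_toSet (Finset.range (f.natDegree + 1))).image f.coeff))
    (exists_mem_componentSet_ne_zero 𝒜 ⟨f.natDegree, by simp, rfl⟩
      (Polynomial.leadingCoeff_ne_zero.2 hf))
    (isHomogeneousElem_of_mem_componentSet 𝒜)
  exact ⟨i, γ, hx0, Ideal.subset_span ⟨_, ⟨i, hi, rfl⟩, γ, rfl⟩, hx⟩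

theorem exists_valuationSubring_of_isGrStarValuationOverring [IsAddTorsionFree Γ]
    (s : SemistarOperation R K) {A : Subalgebra R K} (hA : IsGrValuationOverring 𝒜 A)
    (hsA : ∀ F : Submodule R K, F ≠ ⊥ → F.FG → IsHomogeneousFractionalIdeal 𝒜 F →
      s.star F ≤ F * Subalgebra.toSubmodule A) :
    ∃ W : ValuationSubring (RatFunc K), IsValuationOverringOfKronecker 𝒜 s.eab W ∧
      ∀ α, capPart 𝒜 K (constantsOf W) α =
        capPart 𝒜 K (Subalgebra.toSubmodule A).toAddSubgroup α := by
  obtain ⟨P, hP, hPu, hPc⟩ := exists_prime_homogeneous_nonunits 𝒜 hA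
  let φ : Polynomial A →+* RatFunc K :=
    (algebraMap (Polynomial K) (RatFunc K)).comp (Polynomial.mapRingHom (A.val : A →+* K))
  have hφ : Function.Injective φ := (IsFractionRing.injective (Polynomial K) (RatFunc K)).comp
    (Polynomial.map_injective _ Subtype.val_injective)
  have hφC : ∀ x : A, φ (Polynomial.C x) = algebraMap K (RatFunc K) (x : K) := fun x => by
    change algebraMap (Polynomial K) (RatFunc K) ((Polynomial.C x).map _) = _
    rw [Polynomial.map_C]
    rfl
  have := Ideal.isPrime_map_C_of_isPrime (P := P)
  obtain ⟨W, hW, hWu, hWn⟩ := exists_valuationSubring_of_isPrime φ hφ (P.map Polynomial.C)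
  have hAW : ∀ x ∈ A, algebraMap K (RatFunc K) x ∈ W := fun x hx => hφC ⟨x, hx⟩ ▸ hW _
  refine ⟨W, ?_, fun α => le_antisymm (fun x hx => ⟨?_, hx.2⟩) fun x hx => ⟨hAW x hx.1, hx.2⟩⟩
  · rintro _ ⟨f, g, h, hg, hh, hle, rfl⟩
    obtain rfl | hf := eq_or_ne f 0
    · simp
    obtain ⟨i, β, hxf0, hxf, hf'⟩ := exists_poly_dominant 𝒜 hA hf
    obtain ⟨j, γ, hxg0, hxg, hg'⟩ := exists_poly_dominant 𝒜 hA hg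
    obtain ⟨k, δ, hxh0, hxh, hh'⟩ := exists_poly_dominant 𝒜 hA hh
    set a : R := (DirectSum.decompose 𝒜 (f.coeff i) β : R)
    set b : R := (DirectSum.decompose 𝒜 (g.coeff j) γ : R) with hb
    set c : R := (DirectSum.decompose 𝒜 (h.coeff k) δ : R)
    have ha1 : algebraMap R K a ≠ 0 := by simpa using hxf0
    have hb1 : algebraMap R K b ≠ 0 := by simpa using hxg0
    have hc1 : algebraMap R K c ≠ 0 := by simpa using hxh0
    have haA : a ∈ 𝒜 β := SetLike.coe_mem _
    have hbA : b ∈ 𝒜 γ := SetLike.coe_mem _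
    have hcA : c ∈ 𝒜 δ := SetLike.coe_mem _
    -- The product `a c` lies in `(𝒜_g 𝒜_h)^{⋆_a}`, while `𝒜_g 𝒜_h` lies in `b c A`; the auxiliary
    -- factor `c` then cancels.
    have hab : algebraMap R K a / algebraMap R K b ∈ A := by
      have hI : polyHomogContent 𝒜 g * polyHomogContent 𝒜 h = Ideal.span
          (componentSet 𝒜 (g.coeff '' (Finset.range (g.natDegree + 1) : Set ℕ)) *
            componentSet 𝒜 (h.coeff '' (Finset.range (h.natDegree + 1) : Set ℕ))) := by
        rw [polyHomogContent_eq_span, polyHomogContent_eq_span, Ideal.span_mul_span']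
      have hdom : ∀ y ∈ polyHomogContent 𝒜 g * polyHomogContent 𝒜 h,
          algebraMap R K y / algebraMap R K (b * c) ∈ A := by
        intro y hy
        induction hy using Submodule.mul_induction_on' with
        | mem_mul_mem p hp q hq =>
          rw [map_mul, map_mul, mul_div_mul_comm]
          exact mul_mem (hg' p hp) (hh' q hq)
        | add p _ q _ hp hq => rw [map_add, add_div]; exact add_mem hp hq
      have hmem : algebraMap R K (a * c) ∈ s.eab.star (IsLocalization.coeSubmodule K
          (polyHomogContent 𝒜 g * polyHomogContent 𝒜 h)) :=
        hle ⟨a * c, Ideal.mul_mem_mul hxf hxh, rfl⟩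
      rw [hI] at hdom hmem
      have := div_mem_of_mem_eab 𝒜 s hA hsA
        (Set.Finite.mul
          (finite_componentSet 𝒜 ((Finset.finite_toSet _).image _))
          (finite_componentSet 𝒜 ((Finset.finite_toSet _).image _))) (by
          rintro _ ⟨x, hx, y, hy, rfl⟩
          exact (isHomogeneousElem_of_mem_componentSet 𝒜 x hx).mul
            (isHomogeneousElem_of_mem_componentSet 𝒜 y hy))
        ⟨_, SetLike.mul_mem_graded haA hcA⟩ ⟨_, SetLike.mul_mem_graded hbA hcA⟩ hdom hmem
      rwa [map_mul, map_mul, mul_div_mul_right _ _ hc1] at this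
    obtain ⟨p, -, hp⟩ := exists_map_eq_inv_mul fun i =>
      hf' _ (coeff_mem_polyHomogContent 𝒜 f i)
    obtain ⟨q, hqc, hq⟩ := exists_map_eq_inv_mul fun i =>
      hg' _ (coeff_mem_polyHomogContent 𝒜 g i)
    -- The `j`-th coefficient of `q` is `b⁻¹ g_j`, and `b` is a component of `g_j`. If the
    -- coefficient were in the homogeneous ideal `P`, so would be its component `1`.
    have hqQ : q ∉ P.map Polynomial.C := by
      intro hqQ
      have h1 : (algebraMap R K b)⁻¹ * algebraMap R K (g.coeff j) ∈
          P.toAddSubgroup.map (A.val : A →+ K) :=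
        ⟨q.coeff j, Ideal.mem_map_C_iff.1 hqQ j, hqc j⟩
      have h2 := mul_component_mem 𝒜 hPc
        (inv_mem_quotPart 𝒜 (algebraMap_mem_quotPart 𝒜 hbA)) γ h1
      rw [← hb, inv_mul_cancel₀ hb1] at h2
      obtain ⟨z, hz, hz1⟩ := h2
      rw [show z = 1 from Subtype.ext hz1] at hz
      exact hP.ne_top ((Ideal.eq_top_iff_one P).2 hz)
    have hfac : algebraMap (Polynomial K) (RatFunc K) (f.map (algebraMap R K)) /
        algebraMap (Polynomial K) (RatFunc K) (g.map (algebraMap R K)) =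
        algebraMap K (RatFunc K) (algebraMap R K a / algebraMap R K b) * φ p * (φ q)⁻¹ := by
      have e1 : φ p = (algebraMap K (RatFunc K) (algebraMap R K a))⁻¹ *
          algebraMap (Polynomial K) (RatFunc K) (f.map (algebraMap R K)) := by
        change algebraMap (Polynomial K) (RatFunc K) (p.map _) = _
        rw [hp, map_mul, ← map_inv₀ (algebraMap K (RatFunc K))]; rfl
      have e2 : φ q = (algebraMap K (RatFunc K) (algebraMap R K b))⁻¹ *
          algebraMap (Polynomial K) (RatFunc K) (g.map (algebraMap R K)) := by
        change algebraMap (Polynomial K) (RatFunc K) (q.map _) = _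
        rw [hq, map_mul, ← map_inv₀ (algebraMap K (RatFunc K))]; rfl
      have ha2 : algebraMap K (RatFunc K) (algebraMap R K a) ≠ 0 := by simpa using hxf0
      have hb2 : algebraMap K (RatFunc K) (algebraMap R K b) ≠ 0 := by simpa using hxg0
      rw [e1, e2, map_div₀]
      field_simp
    rw [hfac]
    exact mul_mem (mul_mem (hAW _ hab) (hW p)) (hWu q hqQ)
  · by_contra hxA
    have hx0 : x ≠ 0 := by rintro rfl; exact hxA (zero_mem _)
    have hinv := (hA.2 α x hx.2 hx0).resolve_left hxA
    have hnu : ¬ IsUnit (⟨x⁻¹, hinv⟩ : A) := by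
      intro hu
      obtain ⟨z, hz⟩ := hu.exists_right_inv
      have hz1 : x⁻¹ * (z : K) = 1 := congrArg Subtype.val hz
      refine hxA ?_
      rw [inv_mul_eq_one₀ hx0] at hz1
      rw [hz1]
      exact z.2
    have hxP := (hPu ⟨x⁻¹, hinv⟩ (-α) (inv_mem_quotPart 𝒜 hx.2)).2 hnu
    refine hWn _ (Ideal.mem_map_of_mem Polynomial.C hxP) ?_ ?_
    · rw [Polynomial.C_ne_zero]
      exact fun e => inv_ne_zero hx0 (congrArg Subtype.val e)
    · rw [hφC, ← map_inv₀, inv_inv]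
      exact hx.1

end

end GradedDomain

/-! ### From valuation rings of `K(X)` to gr-`⋆`-valuation overrings. -/

/-- Encodes a finite generating set as a polynomial, so that a finitely generated homogeneous ideal
can be compared with a content ideal. -/
theorem Polynomial.exists_coeff_of_finset {R : Type*} [CommRing R] (S : Finset R) :
    ∃ g : Polynomial R, (∀ x ∈ S, ∃ i, g.coeff i = x) ∧ ∀ i, g.coeff i = 0 ∨ g.coeff i ∈ S := by
  classical
  induction S using Finset.induction_on with
  | empty => exact ⟨0, by simp⟩
  | insert a S _ ih =>
    obtain ⟨g, h, h'⟩ := ih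
    refine ⟨Polynomial.X * g + Polynomial.C a, fun x hx => ?_, fun i => ?_⟩
    · obtain rfl | hx := Finset.mem_insert.1 hx
      · exact ⟨0, by simp⟩
      · obtain ⟨i, rfl⟩ := h x hx
        exact ⟨i + 1, by simp⟩
    · cases i with
      | zero => simp
      | succ i =>
        have := h' i
        simp only [Polynomial.coeff_add, Polynomial.coeff_X_mul, Polynomial.coeff_C_succ, add_zero,
          Finset.mem_insert]
        tauto

namespace GradedDomain

section

variable {Γ : Type*} [AddCommMonoid Γ] [DecidableEq Γ]
  {R : Type*} [CommRing R] (𝒜 : Γ → AddSubgroup R) [GradedRing 𝒜]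

theorem polyHomogContent_one : polyHomogContent 𝒜 1 = 1 := by
  have h := coeff_mem_polyHomogContent 𝒜 1 0
  rw [Polynomial.coeff_one_zero] at h
  rw [Ideal.one_eq_top, Ideal.eq_top_iff_one]
  exact h

theorem polyHomogContent_fg (f : Polynomial R) : (polyHomogContent 𝒜 f).FG := by
  rw [polyHomogContent_eq_span]
  have h := finite_componentSet 𝒜
    ((Finset.finite_toSet (Finset.range (f.natDegree + 1))).image f.coeff)
  exact ⟨h.toFinset, by rw [h.coe_toFinset]⟩

theorem polyHomogContent_C_le {a : R} (ha : SetLike.IsHomogeneousElem 𝒜 a) :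
    polyHomogContent 𝒜 (Polynomial.C a) ≤ Ideal.span {a} := by
  rw [polyHomogContent_eq_span, Ideal.span_le]
  rintro _ ⟨_, ⟨i, -, rfl⟩, γ, rfl⟩
  refine Ideal.homogeneous_span 𝒜 {a} (by simpa using ha) γ ?_
  rw [Polynomial.coeff_C]
  split_ifs
  · exact Ideal.mem_span_singleton_self a
  · exact zero_mem _

variable {K : Type*} [Field K] [Algebra R K]

theorem div_mem_homogKronecker [IsDomain R] (s : SemistarOperation R K) {f g : Polynomial R}
    (hg : g ≠ 0)
    (h : IsLocalization.coeSubmodule K (polyHomogContent 𝒜 f) ≤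
      s.star (IsLocalization.coeSubmodule K (polyHomogContent 𝒜 g))) :
    algebraMap (Polynomial K) (RatFunc K) (f.map (algebraMap R K)) /
      algebraMap (Polynomial K) (RatFunc K) (g.map (algebraMap R K)) ∈ homogKronecker 𝒜 s := by
  refine ⟨f, g, 1, hg, one_ne_zero, ?_, rfl⟩
  rwa [polyHomogContent_one, mul_one, mul_one]

theorem algebraMap_map_mem_of_kronecker [IsDomain R] {s : SemistarOperation R K}
    {W : ValuationSubring (RatFunc K)} (hW : IsValuationOverringOfKronecker 𝒜 s W)
    (f : Polynomial R) :
    algebraMap (Polynomial K) (RatFunc K) (f.map (algebraMap R K)) ∈ W := by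
  have h := hW (div_mem_homogKronecker 𝒜 s (f := f) (one_ne_zero (α := Polynomial R)) ?_)
  · simpa using h
  · rw [polyHomogContent_one, Ideal.one_eq_top]
    exact (IsLocalization.coeSubmodule_mono K le_top).trans (s.le_star _)

end

section

variable {Γ : Type*} [AddCommMonoid Γ] [IsCancelAdd Γ] [DecidableEq Γ]
  {R : Type*} [CommRing R] [IsDomain R] (𝒜 : Γ → AddSubgroup R) [GradedRing 𝒜]
  {K : Type*} [Field K] [Algebra R K] [IsFractionRing R K]

open Algebra.GrothendieckAddGroup (of of_injective)

theorem isGrStarValuationOverring_of_valuationSubring {s : SemistarOperation R K}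
    (hs : IsHomogeneousPreserving 𝒜 s) {V : AddSubgroup K} {W : ValuationSubring (RatFunc K)}
    (hW : IsValuationOverringOfKronecker 𝒜 s.eab W)
    (hV : V = ⨆ α, capPart 𝒜 K (constantsOf W) α) :
    IsGrStarValuationOverring 𝒜 s V := by
  classical
  have hcap : ∀ α, capPart 𝒜 K (constantsOf W) α ≤ V := fun α => hV ▸ le_iSup _ α
  have hVW : V ≤ constantsOf W := hV ▸ iSup_le fun α => inf_le_left
  have hRW : ∀ r : R, algebraMap R K r ∈ constantsOf W := fun r => by
    have h := algebraMap_map_mem_of_kronecker 𝒜 hW (Polynomial.C r)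
    rw [Polynomial.map_C] at h
    exact h
  have hX : algebraMap (Polynomial K) (RatFunc K) Polynomial.X ∈ W := by
    have h := algebraMap_map_mem_of_kronecker 𝒜 hW Polynomial.X
    rwa [Polynomial.map_X] at h
  have hpoly : ∀ p : Polynomial K, (∀ i, p.coeff i ∈ constantsOf W) →
      algebraMap (Polynomial K) (RatFunc K) p ∈ W := fun p hp => by
    rw [p.as_sum_range_C_mul_X_pow, map_sum]
    refine sum_mem fun i _ => ?_
    rw [map_mul, map_pow]
    exact mul_mem (hp i) (pow_mem hX i)
  have hmul : ∀ x ∈ V, ∀ y ∈ V, x * y ∈ V := by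
    have h1 : ∀ α, ∀ x ∈ capPart 𝒜 K (constantsOf W) α, ∀ y ∈ V, x * y ∈ V := by
      intro α x hx
      have : (⨆ β, capPart 𝒜 K (constantsOf W) β) ≤ V.comap (AddMonoidHom.mulLeft x) := by
        refine iSup_le fun β y hy => hcap (α + β) ⟨?_, mul_mem_quotPart 𝒜 hx.2 hy.2⟩
        change algebraMap K (RatFunc K) (x * y) ∈ W
        rw [map_mul]
        exact mul_mem hx.1 hy.1
      rw [← hV] at this
      exact this
    intro x hx y hy
    have : (⨆ β, capPart 𝒜 K (constantsOf W) β) ≤ V.comap (AddMonoidHom.mulRight y) :=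
      iSup_le fun β x hx => h1 β x hx y hy
    rw [← hV] at this
    exact this hx
  have hRV : ∀ r : R, algebraMap R K r ∈ V := fun r => by
    rw [← DirectSum.sum_support_decompose 𝒜 r, map_sum]
    exact sum_mem fun γ _ => hcap _ ⟨hRW _, algebraMap_mem_quotPart 𝒜 (SetLike.coe_mem _)⟩
  let A : Subalgebra R K :=
    { carrier := V
      mul_mem' := fun {x y} hx hy => hmul x hx y hy
      add_mem' := fun {x y} hx hy => V.add_mem hx hy
      algebraMap_mem' := hRV }
  have hAV : (Subalgebra.toSubmodule A).toAddSubgroup = V := rfl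
  have hA : IsGrValuationOverring 𝒜 A := by
    refine ⟨⟨(iSupIndep_quotPart 𝒜).mono fun α => inf_le_right,
      le_antisymm ?_ (iSup_le fun α => inf_le_left)⟩, fun α x hx hx0 => ?_⟩
    · rw [hAV]
      exact hV.le.trans (iSup_mono fun α => le_inf (hcap α) inf_le_right)
    · refine (W.mem_or_inv_mem (algebraMap K (RatFunc K) x)).imp (fun h => hcap α ⟨h, hx⟩)
        fun h => hcap (-α) ⟨?_, inv_mem_quotPart 𝒜 hx⟩
      rw [← map_inv₀] at h
      exact h
  refine ⟨A, hAV, hA, fun F hF0 hFfg hF => ?_⟩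
  -- Homogeneous preservation enters here: it makes `F^⋆` the sum of its homogeneous parts, so
  -- homogeneous `y` suffice.
  have hFs := (hs F hF0 hF).2
  obtain ⟨h, hh0, ⟨η, hη⟩, I, hIh, hFI⟩ := hF
  have hh1 : algebraMap R K h ≠ 0 := by simpa using hh0
  suffices hsuff : ∀ α, capPart 𝒜 K (s.star F).toAddSubgroup α ≤
      (F * Subalgebra.toSubmodule A).toAddSubgroup by
    have := iSup_le hsuff
    rw [← hFs] at this
    exact this
  rintro α y ⟨hyF, hy⟩
  have hIfg : I.FG := by
    refine (IsLocalization.coeSubmodule_fg K (IsFractionRing.injective R K) I).1 ?_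
    rw [← hFI]
    exact hFfg.map _
  obtain ⟨T, hT⟩ := hIfg
  have hSI : Ideal.span (componentSet 𝒜 (T : Set R)) = I := by
    refine le_antisymm (Ideal.span_le.2 ?_) ?_
    · rintro _ ⟨t, ht, γ, rfl⟩
      exact hIh γ (hT ▸ Ideal.subset_span ht)
    · rw [← hT, Submodule.span_le]
      exact subset_span_componentSet 𝒜 _
  have hSfin := finite_componentSet 𝒜 T.finite_toSet
  have hI0 : I ≠ ⊥ := by
    rintro rfl
    obtain ⟨z, hz, hz0⟩ := Submodule.exists_mem_ne_zero_of_ne_bot hF0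
    have h1 := Submodule.smul_mem_pointwise_smul z (algebraMap R K h) _ hz
    rw [hFI, IsLocalization.coeSubmodule_bot, Submodule.mem_bot] at h1
    exact mul_ne_zero hh1 hz0 h1
  obtain ⟨x, hxS, hx0, hx⟩ := exists_dominant 𝒜 hA hSfin
    (by by_contra! hc; exact hI0 (hSI ▸ Ideal.span_eq_bot.2 hc))
    (isHomogeneousElem_of_mem_componentSet 𝒜)
  obtain ⟨ξ, hξ⟩ := isHomogeneousElem_of_mem_componentSet 𝒜 x hxS
  have hx1 : algebraMap R K x ≠ 0 := by simpa using hx0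
  have hyx : algebraMap R K h * y / algebraMap R K x ∈ quotPart 𝒜 K (of η + α - of ξ) :=
    div_mem_quotPart 𝒜 (mul_mem_quotPart 𝒜 (algebraMap_mem_quotPart 𝒜 hη) hy)
      (algebraMap_mem_quotPart 𝒜 hξ)
  -- Since `x` lies in `hF`, write `x = h z` with `z` in `F`; then `y = z · (h y / x)`, and the
  -- second factor is homogeneous, so it lies in `V` once it lies in `W`.
  suffices hmem : algebraMap R K h * y / algebraMap R K x ∈ constantsOf W by
    have hxI : algebraMap R K x ∈ algebraMap R K h • F := by
      rw [hFI]
      exact ⟨x, hSI ▸ Ideal.subset_span hxS, rfl⟩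
    obtain ⟨z, hz, e⟩ := (Submodule.mem_smul_pointwise_iff_exists _ _ _).1 hxI
    rw [smul_eq_mul] at e
    have hyz : y = z * (algebraMap R K h * y / algebraMap R K x) := by
      rw [mul_div_assoc', eq_div_iff hx1, ← e]; ring
    rw [hyz]
    exact Submodule.mul_mem_mul hz (hcap _ ⟨hmem, hyx⟩)
  obtain rfl | ⟨β, γ, a, ha, b, hb, hb0, -, rfl⟩ := hy
  · rw [mul_zero, zero_div]; exact zero_mem _
  have hb1 : algebraMap R K b ≠ 0 := by simpa using hb0
  -- With `y = a/b`, scaling the generators of `I = hF` by `b` puts `h a = b h y` in `(bI)^⋆`, hence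
  -- in the `⋆`-closure of the content of `g`.
  obtain ⟨g, hgS, hgS'⟩ := Polynomial.exists_coeff_of_finset
    (hSfin.toFinset.image (b * ·))
  have hgx : ∃ i, g.coeff i = b * x :=
    hgS _ (Finset.mem_image.2 ⟨x, by simpa using hxS, rfl⟩)
  have hg0 : g ≠ 0 := by
    rintro rfl
    obtain ⟨i, hi⟩ := hgx
    rw [Polynomial.coeff_zero] at hi
    exact mul_ne_zero hb0 hx0 hi.symm
  have hle : algebraMap R K b • IsLocalization.coeSubmodule K I ≤
      IsLocalization.coeSubmodule K (polyHomogContent 𝒜 g) := by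
    rw [← hSI]
    rintro _ ⟨_, ⟨z, hz, rfl⟩, rfl⟩
    induction hz using Submodule.span_induction with
    | mem z hz =>
      obtain ⟨i, hi⟩ := hgS (b * z) (Finset.mem_image.2 ⟨z, by simpa using hz, rfl⟩)
      refine ⟨b * z, hi ▸ coeff_mem_polyHomogContent 𝒜 g i, ?_⟩
      simp
    | zero => simp
    | add z w _ _ hz hw => rw [map_add, map_add]; exact add_mem hz hw
    | smul r z _ hz =>
      rw [map_smul, map_smul]
      exact Submodule.smul_mem _ r hz
  have hmem : algebraMap R K (h * a) ∈
      s.eab.star (IsLocalization.coeSubmodule K (polyHomogContent 𝒜 g)) := by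
    have h1 := Submodule.smul_mem_pointwise_smul _ (algebraMap R K b) _
      (Submodule.smul_mem_pointwise_smul _ (algebraMap R K h) _ hyF)
    rw [← s.star_smul _ hh1, hFI, ← s.star_smul _ hb1] at h1
    have h2 := s.star_mono _ _ hle h1
    have e : algebraMap R K b • algebraMap R K h • (algebraMap R K a / algebraMap R K b) =
        algebraMap R K (h * a) := by
      rw [smul_eq_mul, smul_eq_mul, map_mul]; field_simp
    rw [e] at h2
    -- On a finitely generated module `⋆_a` contains `⋆`: take the auxiliary module to be `R`
    -- itself.
    refine s.mem_eabSubmodule.2 ⟨_, ?_, le_rfl, 1, SemistarOperation.one_fg',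
      SemistarOperation.one_ne_bot', fun z hz => ?_⟩
    · exact Submodule.FG.map _ (polyHomogContent_fg 𝒜 g)
    · exact s.star_mul_le _ _ (Submodule.mul_mem_mul h2 hz)
  have hfg := hW (div_mem_homogKronecker 𝒜 s.eab (f := Polynomial.C (h * a)) hg0 (by
    refine (IsLocalization.coeSubmodule_mono K
      (polyHomogContent_C_le 𝒜 ⟨_, SetLike.mul_mem_graded hη ha⟩)).trans ?_
    rw [IsLocalization.coeSubmodule_span_singleton, Submodule.span_singleton_le_iff_mem]
    exact hmem))
  have hgW : algebraMap (Polynomial K) (RatFunc K)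
      (Polynomial.C (algebraMap R K (b * x))⁻¹ * g.map (algebraMap R K)) ∈ W := by
    refine hpoly _ fun i => ?_
    rw [Polynomial.coeff_C_mul, Polynomial.coeff_map]
    obtain h0 | h1 := hgS' i
    · rw [h0, map_zero, mul_zero]; exact zero_mem _
    · obtain ⟨z, hz, e⟩ := Finset.mem_image.1 h1
      rw [← e, map_mul, map_mul, ← div_eq_inv_mul, mul_div_mul_left _ _ hb1]
      exact hVW (hx z (Ideal.subset_span (by simpa using hz)))
  -- The product of `h a / g` and `g / (b x)` is the constant `h a / (b x) = h y / x`.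
  have hprod := mul_mem hfg hgW
  have hgK : algebraMap (Polynomial K) (RatFunc K) (g.map (algebraMap R K)) ≠ 0 := by
    rw [Ne, map_eq_zero_iff _ (IsFractionRing.injective (Polynomial K) (RatFunc K)),
      Polynomial.map_eq_zero_iff (IsFractionRing.injective R K)]
    exact hg0
  rw [map_mul _ (Polynomial.C _), mul_left_comm, div_mul_cancel₀ _ hgK, ← map_mul, Polynomial.map_C,
    ← Polynomial.C_mul] at hprod
  have e : algebraMap R K h * (algebraMap R K a / algebraMap R K b) / algebraMap R K x =
      (algebraMap R K (b * x))⁻¹ * algebraMap R K (h * a) := by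
    rw [map_mul, map_mul]
    field_simp
  rw [e]
  exact hprod

end

end GradedDomain

theorem mainTheorem2 {Γ : Type*} [AddCommMonoid Γ] [IsCancelAdd Γ] [IsAddTorsionFree Γ]
    [DecidableEq Γ] {R : Type*} [CommRing R] [IsDomain R] (𝒜 : Γ → AddSubgroup R) [GradedRing 𝒜]
    {K : Type*} [Field K] [Algebra R K] [IsFractionRing R K]
    (s : SemistarOperation R K) (hs : GradedDomain.IsHomogeneousPreserving 𝒜 s)
    (V : AddSubgroup K) :
    GradedDomain.IsGrStarValuationOverring 𝒜 s V ↔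
      ∃ W : ValuationSubring (RatFunc K),
        GradedDomain.IsValuationOverringOfKronecker 𝒜 s.eab W ∧
        GradedDomain.IsInternalDirectSum V (GradedDomain.capPart 𝒜 K (GradedDomain.constantsOf W)) := by
  constructor
  · rintro ⟨A, rfl, hA, hsA⟩
    obtain ⟨W, hW, hcap⟩ :=
      GradedDomain.exists_valuationSubring_of_isGrStarValuationOverring 𝒜 s hA hsA
    refine ⟨W, hW, ?_⟩
    rw [funext hcap]
    exact hA.1
  · rintro ⟨W, hW, -, hV⟩
    exact GradedDomain.isGrStarValuationOverring_of_valuationSubring 𝒜 hs hW hV
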